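/- Setting. Equip $\mathbb{R}^d$ with an arbitrary norm $\|\cdot\|$ and let $\|\cdot\|_*$ be its dual norm. A loss is $\ell:\mathbb{R}\times\mathbb{R}\to[0,\infty)$ such that, for some convex $\tilde\ell:\mathbb{R}\to[0,\infty)$, either $\ell(y,\hat y)=\tilde\ell(\mathrm{sgn}(y)\hat y)$, where $\mathrm{sgn}(y)=2\cdot\mathbf 1[y\ge 0]-1$, or $\ell(y,\hat y)=\tilde\ell(y-\hat y)$. It is $(C_1,C_2)$-quadratically-bounded, for $C_1,C_2\ge 0$, if a selection $\ell'$ of its subgradients in the second argument satisfies $|\ell'(y,\hat y)|\le C_1+C_2(|y|+|\hat y|)$ for all $y,\hat y$. A mirror map is $\psi:\mathbb{R}^d\to(-\infty,\infty]$ that is $1$-strongly convex with respect to $\|\cdot\|$ on $\mathrm{dom}(\psi)=\{\psi<\infty\}$ and differentiable on the interior of $\mathrm{dom}(\psi)$; its Bregman divergence is $D_\psi(w,v)=\psi(w)-\psi(v)-\langle\nabla\psi(v),w-v\rangle$. Let $(x_i,y_i)_{i\ge 0}$ be a stochastic process in $\mathbb{R}^d\times\mathbb{R}$ adapted to a filtration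 $(\mathcal F_i)_{i\ge0}$. Let $t,\tau\ge 1$ be integers and $\pi$ a probability measure on $\mathbb{R}^d\times\mathbb{R}$ such that $(\pi,\tau,1/\sqrt t)$ is an approximate stationarity witness: for every $s\ge 0$, almost surely, the conditional law of $(x_{s+\tau},y_{s+\tau})$ given $\mathcal F_s$ is within total variation distance $\sup_A|P(A)-\pi(A)|\le 1/\sqrt t$ of $\pi$. Put $\mathcal R(w)=\mathbb{E}_{(x,y)\sim\pi}\,\ell(y,x^{\mathsf T}w)$ and $\mathcal E(w)=\mathcal R(w)-\inf_{v\in\mathrm{dom}(\psi)}\mathcal R(v)$. Given $w_0$ and $\eta>0$, unprojected stochastic mirror descent chooses subgradients $g_{i+1}\in\partial_w\,\ell(y_{i+1},x_{i+1}^{\mathsf T}w)\big|_{w=w_i}$, with $g_{i+1}$ being $\mathcal F_{i+1}$-measurable, and sets $$w_{i+1}\in\arg\min_{w\in\mathbb{R}^d}\big(\langle\eta g_{i+1},w\rangle+D_\psi(w,w_i)\big),\qquad 0\le i<t,$$ where all iterates $w_0,\dots,w_t$ are assumed to lie in the interior of $\mathrm{dom}(\psi)$, so that the gradients $\nabla\psi(w_i)$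 exist (this is automatic for $w_1,\dots,w_t$ if $\mathrm{dom}(\psi)$ is open). Theorem. Suppose $\ell$ is a loss as above which is $(C_1,C_2)$-quadratically-bounded, that $\max\{\|x_i\|_*,|y_i|\}\le 1$ almost surely for $1\le i\le t$, and that also $\max\{\|x\|_*,|y|\}\le 1$ for $\pi$-almost every $(x,y)$. Let $w_{\mathrm{ref}}\in\mathrm{dom}(\psi)$ satisfy $\mathcal E(w_{\mathrm{ref}})\le D_\psi(w_{\mathrm{ref}},w_0)/\sqrt t$. Let $0<\delta\le 1/2$, $$B_w=\max\Big\{1,\ \mathbf 1[C_2>0]\,\|w_{\mathrm{ref}}\|,\ 4\sqrt{D_\psi(w_{\mathrm{ref}},w_0)}\Big\},\qquad 0<\eta\le\frac{1}{4096\,\max\{1,C_1,C_2\}\sqrt{t\,\tau\ln(1/\delta)}}.$$ Then with probability at least $1-t\tau\delta$, every $1\le i\le t$ satisfies $$\frac{1}{i\eta}D_\psi(w_{\mathrm{ref}},w_i)+\frac1i\sum_{j<i}\mathcal R(w_j)\ \le\ \frac{B_w^2}{8i\eta}+\mathcal R(w_{\mathrm{ref}}).$$ -/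

import Mathlib

open MeasureTheory ProbabilityTheory Set Filter

noncomputable section

namespace MirrorDescent

/-! ### Losses -/

/-- `sgn(y) = 2 * 1[y ≥ 0] - 1`, with values in `{-1, +1}`. -/
def sgn (y : ℝ) : ℝ := if 0 ≤ y then 1 else -1

/-- A convex loss `ℓ(y, ŷ) ≥ 0`: there is a convex nonnegative scalar function `φ` such that either
`ℓ(y, ŷ) = φ(sgn(y) ŷ)` (classification) or `ℓ(y, ŷ) = φ(y - ŷ)` (regression). -/
def IsConvexLoss (ℓ : ℝ → ℝ → ℝ) : Prop :=
  ∃ φ : ℝ → ℝ, ConvexOn ℝ univ φ ∧ (∀ z, 0 ≤ φ z) ∧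
    ((∀ y z, ℓ y z = φ (sgn y * z)) ∨ (∀ y z, ℓ y z = φ (y - z)))

/-- `s` is a subgradient of `f : ℝ → ℝ` at `z`. -/
def IsScalarSubgradient (f : ℝ → ℝ) (z s : ℝ) : Prop :=
  ∀ z', f z + s * (z' - z) ≤ f z'

/-- `ℓ` is `(C₁, C₂)`-quadratically-bounded: some selection `ℓ'` of subgradients in the second
argument satisfies `|ℓ'(y, ŷ)| ≤ C₁ + C₂ (|y| + |ŷ|)` for all `y`, `ŷ`. -/
def IsQuadraticallyBounded (ℓ : ℝ → ℝ → ℝ) (C₁ C₂ : ℝ) : Prop :=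
  ∃ ℓ' : ℝ → ℝ → ℝ, ∀ y z,
    IsScalarSubgradient (ℓ y) z (ℓ' y z) ∧ |ℓ' y z| ≤ C₁ + C₂ * (|y| + |z|)

section Space

/- `E` is `ℝ^d` with an arbitrary norm. Covariates `x` (and gradients) live in the dual space, so that
`x w` is `x^T w` and the operator norm of `x` is the dual norm of `x`. -/
variable {E : Type*} [NormedAddCommGroup E] [NormedSpace ℝ E]

/-- A data point `(x, y)`. -/
abbrev DataPoint (E : Type*) [NormedAddCommGroup E] [NormedSpace ℝ E] : Type _ :=
  StrongDual ℝ E × ℝ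

/-- `ℓ_{x,y}(v) = ℓ(y, x^T v)`. -/
def pointLoss (ℓ : ℝ → ℝ → ℝ) (z : DataPoint E) (v : E) : ℝ := ℓ z.2 (z.1 v)

/-- `g` is a subgradient of `f : E → ℝ` at `v`. -/
def IsSubgradient (f : E → ℝ) (v : E) (g : StrongDual ℝ E) : Prop :=
  ∀ u, f v + g (u - v) ≤ f u

/-! ### Mirror maps -/

/-- `dom(ψ) = {u : ψ(u) < ∞}`. -/
def effDom (ψ : E → EReal) : Set E := {u | ψ u < ⊤}

/-- `ψ` as a real-valued function; meaningful on `effDom ψ`. -/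
def realVal (ψ : E → EReal) (u : E) : ℝ := (ψ u).toReal

/-- A mirror map with values in `(-∞, +∞]`: `1`-strongly convex on its domain (with respect to the
norm of `E`) and differentiable on the interior of its domain. -/
structure IsMirrorMap (ψ : E → EReal) : Prop where
  ne_bot : ∀ u, ψ u ≠ ⊥
  strongConvexOn : StrongConvexOn (effDom ψ) 1 (realVal ψ)
  differentiableAt : ∀ v ∈ interior (effDom ψ), DifferentiableAt ℝ (realVal ψ) v

/-- The Bregman divergence `D_ψ(w, v) = ψ(w) - [ψ(v) + ⟨∇ψ(v), w - v⟩]`, for `w ∈ dom(ψ)` and `v` in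
the interior of `dom(ψ)`. -/
def bregman (ψ : E → EReal) (w v : E) : ℝ :=
  realVal ψ w - (realVal ψ v + fderiv ℝ (realVal ψ) v (w - v))

/-- `v'` minimizes `u ↦ ⟨η g, u⟩ + D_ψ(u, v)` over the whole space; the objective is `+∞` outside
`dom(ψ)`, so this is a minimization over `dom(ψ)`. -/
def IsMirrorStep (ψ : E → EReal) (η : ℝ) (g : StrongDual ℝ E) (v v' : E) : Prop :=
  v' ∈ effDom ψ ∧ ∀ u ∈ effDom ψ, η * g v' + bregman ψ v' v ≤ η * g u + bregman ψ u v

/-- `(w i)` for `i ≤ t` is a run of unprojected mirror descent on the objectives `f 1, …, f t`, started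
at `w₀`, with step size `η` and subgradients `g (i + 1) ∈ ∂ (f (i + 1)) (w i)`. The iterates lie in the
interior of `dom(ψ)`, so that the gradients `∇ψ (w i)` in the recursion exist. -/
structure IsMirrorDescentRun (ψ : E → EReal) (η : ℝ) (t : ℕ) (f : ℕ → E → ℝ) (w₀ : E)
    (g : ℕ → StrongDual ℝ E) (w : ℕ → E) : Prop where
  start : w 0 = w₀
  mem_interior : ∀ i ≤ t, w i ∈ interior (effDom ψ)
  subgradient : ∀ i < t, IsSubgradient (f (i + 1)) (w i) (g (i + 1))
  step : ∀ i < t, IsMirrorStep ψ η (g (i + 1)) (w i) (w (i + 1))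

/-! ### Risk -/

/-- The risk `R(w) = E_{(x,y) ∼ π} ℓ(y, x^T w)`. -/
def risk (ℓ : ℝ → ℝ → ℝ) (π : Measure (DataPoint E)) (w : E) : ℝ :=
  ∫ z, pointLoss ℓ z w ∂π

/-- The excess risk `R(w) - inf_{v ∈ dom(ψ)} R(v)`. -/
def excessRisk (ℓ : ℝ → ℝ → ℝ) (π : Measure (DataPoint E)) (ψ : E → EReal) (w : E) : ℝ :=
  risk ℓ π w - sInf (risk ℓ π '' effDom ψ)

end Space

/-! ### Approximate stationarity -/

/-- Total variation distance `sup_A |P(A) - Q(A)|` over measurable sets `A`. -/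
def tvDist {α : Type*} [MeasurableSpace α] (P Q : Measure α) : ℝ :=
  ⨆ A : {A : Set α // MeasurableSet A}, |P.real A - Q.real A|

/-- The regular conditional distribution of `Y` given the σ-algebra `m`, at `ω`. -/
def condLaw {Ω α : Type*} [MeasurableSpace α] [StandardBorelSpace α] [Nonempty α]
    {mΩ : MeasurableSpace Ω} (μ : Measure Ω) [IsFiniteMeasure μ] (Y : Ω → α)
    (m : MeasurableSpace Ω) (ω : Ω) : Measure α :=
  @condDistrib Ω Ω α _ _ _ mΩ m Y id μ _ ω

/-- `(π, τ, ε)` is an approximate stationarity witness for the process `Z` with respect to the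
filtration `ℱ`: for every time `s`, almost surely, the conditional law of `Z (s + τ)` given `ℱ s` is
within total variation distance `ε` of `π`. -/
def IsStationarityWitness {Ω α : Type*} [MeasurableSpace α] [StandardBorelSpace α] [Nonempty α]
    {mΩ : MeasurableSpace Ω} (μ : Measure Ω) [IsFiniteMeasure μ] (ℱ : Filtration ℕ mΩ)
    (Z : ℕ → Ω → α) (π : Measure α) (τ : ℕ) (ε : ℝ) : Prop :=
  ∀ s : ℕ, ∀ᵐ ω ∂μ, tvDist (condLaw μ (Z (s + τ)) (ℱ s) ω) π ≤ ε

/-- `B_w = max {1, 1[C₂ > 0] ‖w_ref‖, 4 √(D_ψ(w_ref, w₀))}`. -/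
def radius {E : Type*} [NormedAddCommGroup E] [NormedSpace ℝ E] (ψ : E → EReal) (C₂ : ℝ)
    (wref w₀ : E) : ℝ :=
  max 1 (max (if 0 < C₂ then ‖wref‖ else 0) (4 * √(bregman ψ wref w₀)))

end MirrorDescent

end

/-! As long as the gradients have norm at most G, the regret inequality bounds D(wref, w_i) plus η
times the summed observed losses relative to `wref` by D(wref, w₀) + iη²G²/2. It remains to trade
observed losses for risks.

The iterate w_j depends on recent data, so z_{j+1} is not fresh for it. Going back to s = j + 1 - τ
repairs this: given ℱ_s, w_s is frozen and z_{s+τ} has law within 1/√t of π. Each step moves an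
iterate by at most ηG, so the shift costs O(τηG²) per term (`sum_range_le_of_lag`). The remaining
fluctuations split into τ residue classes mod τ. Within a class each term is measurable before the
next is conditioned on, so Chernoff's method applies; a union bound over t times and τ classes gives
the failure probability tτδ (`one_sub_le_measureReal_forall_sum_le`).

Without projection, G is available only near `wref`. Concentration is therefore proved for
`clippedLoss`, which is bounded everywhere. On the good event, strong induction in
`bregman_add_regret_le` shows that the iterates used never leave the ball where clipping is
inactive: small regret forces small divergence, because `wref` is nearly optimal, and strong
convexity turns this into small distance. -/

noncomputable section

namespace MirrorDescent

/-! ### Mirror maps: strong convexity, one step, adaptedness of the iterates -/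

section MirrorMaps

variable {E : Type*} [NormedAddCommGroup E] [NormedSpace ℝ E] {ψ : E → EReal}

/-- Strong convexity, in first-order form. -/
lemma IsMirrorMap.half_sq_norm_le_bregman (hψ : IsMirrorMap ψ) {u v : E} (hu : u ∈ effDom ψ)
    (hv : v ∈ interior (effDom ψ)) : ‖u - v‖ ^ 2 / 2 ≤ bregman ψ u v := by
  set f := realVal ψ with hf
  have hd : HasDerivAt (fun a : ℝ => f (v + a • (u - v))) (fderiv ℝ f v (u - v)) 0 := by
    have h1 : HasFDerivAt f (fderiv ℝ f v) (v + (0 : ℝ) • (u - v)) := by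
      simpa using (hψ.differentiableAt v hv).hasFDerivAt
    have h2 : HasDerivAt (fun a : ℝ => v + a • (u - v)) (u - v) 0 := by
      simpa using ((hasDerivAt_id (0 : ℝ)).smul_const (u - v)).const_add v
    exact h1.comp_hasDerivAt 0 h2
  have hs := (hasDerivAt_iff_tendsto_slope.1 hd).mono_left
    (nhdsWithin_mono (0 : ℝ) (fun x (hx : x ∈ Ioi (0 : ℝ)) => ne_of_gt hx))
  have ht : Tendsto (fun a : ℝ => f u - f v - (1 - a) * (‖u - v‖ ^ 2 / 2)) (nhdsWithin 0 (Ioi 0))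
      (nhds (f u - f v - (1 - 0) * (‖u - v‖ ^ 2 / 2))) := by
    apply Tendsto.mono_left _ nhdsWithin_le_nhds
    exact Continuous.tendsto (by fun_prop) 0
  -- Strong convexity at a•u + (1 - a)•v, divided by a, bounds the difference quotient; then a → 0+.
  have key := le_of_tendsto_of_tendsto hs ht (by
    have hI : Ioo (0 : ℝ) 1 ∈ nhdsWithin (0 : ℝ) (Ioi 0) := Ioo_mem_nhdsGT one_pos
    filter_upwards [hI] with a ha
    have h := hψ.strongConvexOn.2 hu (interior_subset hv) ha.1.le (by linarith [ha.2] : 0 ≤ 1 - a)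
      (by ring)
    have e : a • u + (1 - a) • v = v + a • (u - v) := by
      rw [smul_sub, sub_smul, one_smul]; abel
    rw [e] at h
    simp only [smul_eq_mul, ← hf] at h
    rw [slope_def_field, div_le_iff₀ (by linarith [ha.1])]
    simp only [zero_smul, add_zero]
    nlinarith [h])
  unfold bregman
  rw [← hf]
  linarith

/-- Adding the first-order inequality to itself with u and v exchanged gives strong monotonicity of
the gradient. This controls the length of a step and makes the gradient map injective with a
1-Lipschitz inverse. -/
lemma IsMirrorMap.norm_sub_le_norm_fderiv_sub (hψ : IsMirrorMap ψ) {u v : E}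
    (hu : u ∈ interior (effDom ψ)) (hv : v ∈ interior (effDom ψ)) :
    ‖u - v‖ ≤ ‖fderiv ℝ (realVal ψ) u - fderiv ℝ (realVal ψ) v‖ := by
  have h1 := hψ.half_sq_norm_le_bregman (interior_subset hu) hv
  have h2 := hψ.half_sq_norm_le_bregman (interior_subset hv) hu
  have h3 : bregman ψ u v + bregman ψ v u
      = (fderiv ℝ (realVal ψ) u - fderiv ℝ (realVal ψ) v) (u - v) := by
    simp only [bregman, sub_apply, map_sub]; ring
  have h4 := (le_abs_self _).trans
    ((fderiv ℝ (realVal ψ) u - fderiv ℝ (realVal ψ) v).le_opNorm (u - v))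
  rw [norm_sub_rev v u] at h2
  rcases (norm_nonneg (u - v)).eq_or_lt with h0 | h0
  · rw [← h0]; positivity
  · by_contra! hc
    nlinarith [mul_lt_mul_of_pos_right hc h0]

/-- First-order optimality of a mirror step. -/
lemma IsMirrorStep.fderiv_eq (hψ : IsMirrorMap ψ) {η : ℝ} {g : StrongDual ℝ E} {v v' : E}
    (hv' : v' ∈ interior (effDom ψ)) (h : IsMirrorStep ψ η g v v') :
    fderiv ℝ (realVal ψ) v' = fderiv ℝ (realVal ψ) v - η • g := by
  have hmin : IsLocalMin (fun u => η * g u + bregman ψ u v) v' := by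
    filter_upwards [mem_interior_iff_mem_nhds.1 hv'] with u hu using h.2 u hu
  have hd : HasFDerivAt (fun u => η * g u + bregman ψ u v)
      (η • g + (fderiv ℝ (realVal ψ) v' - fderiv ℝ (realVal ψ) v)) v' := by
    refine (g.hasFDerivAt.const_mul η).add ?_
    refine (hψ.differentiableAt v' hv').hasFDerivAt.sub ?_
    refine HasFDerivAt.const_add _ ?_
    exact (fderiv ℝ (realVal ψ) v).hasFDerivAt.comp v' ((hasFDerivAt_id v').sub_const v)
  have h0 := hmin.hasFDerivAt_eq_zero hd
  rw [eq_sub_iff_add_eq, ← sub_eq_zero, ← h0]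
  abel

lemma IsMirrorStep.norm_sub_le (hψ : IsMirrorMap ψ) {η : ℝ} (hη : 0 ≤ η) {g : StrongDual ℝ E}
    {v v' : E} (hv : v ∈ interior (effDom ψ)) (hv' : v' ∈ interior (effDom ψ))
    (h : IsMirrorStep ψ η g v v') : ‖v' - v‖ ≤ η * ‖g‖ := by
  have h1 := hψ.norm_sub_le_norm_fderiv_sub hv' hv
  rwa [h.fderiv_eq hψ hv', sub_sub_cancel_left, norm_neg, norm_smul, Real.norm_of_nonneg hη] at h1

/-- The one-step inequality of mirror descent. -/
lemma IsMirrorStep.bregman_le (hψ : IsMirrorMap ψ) {η : ℝ} (hη : 0 ≤ η) {g : StrongDual ℝ E}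
    {u v v' : E} (hv : v ∈ interior (effDom ψ))
    (hv' : v' ∈ interior (effDom ψ)) (h : IsMirrorStep ψ η g v v') :
    bregman ψ u v' ≤ bregman ψ u v + η * g (u - v) + η ^ 2 * ‖g‖ ^ 2 / 2 := by
  have h1 := hψ.half_sq_norm_le_bregman (interior_subset hv') hv
  -- Three-point identity, after inserting the optimality condition for ∇ψ(v').
  have h2 : bregman ψ u v' = bregman ψ u v - bregman ψ v' v + η * g (u - v) + η * g (v - v') := by
    simp only [bregman, h.fderiv_eq hψ hv', sub_apply,
      smul_apply, smul_eq_mul, map_sub]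
    ring
  have h3 : g (v - v') ≤ ‖g‖ * ‖v' - v‖ := by
    rw [norm_sub_rev]; exact (le_abs_self _).trans (g.le_opNorm _)
  have h4 := mul_le_mul_of_nonneg_left h3 hη
  -- Young's inequality: η‖g‖d - d²/2 ≤ η²‖g‖²/2 with d = ‖v' - v‖.
  nlinarith [sq_nonneg (‖v' - v‖ - η * ‖g‖)]

lemma IsMirrorDescentRun.fderiv_eq (hψ : IsMirrorMap ψ) {η : ℝ} {t : ℕ} {f : ℕ → E → ℝ} {w₀ : E}
    {g : ℕ → StrongDual ℝ E} {w : ℕ → E} (h : IsMirrorDescentRun ψ η t f w₀ g w) {i : ℕ}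
    (hi : i ≤ t) : fderiv ℝ (realVal ψ) (w i)
      = fderiv ℝ (realVal ψ) w₀ - η • ∑ j ∈ Finset.range i, g (j + 1) := by
  induction i with
  | zero => simp [h.start]
  | succ i ih =>
    rw [(h.step i hi).fderiv_eq hψ (h.mem_interior _ hi), ih (by omega), Finset.sum_range_succ,
      smul_add]
    abel

/-- The gradient of a mirror map has a continuous left inverse. -/
lemma IsMirrorMap.exists_continuous_leftInverse [FiniteDimensional ℝ E] (hψ : IsMirrorMap ψ) :
    ∃ h : StrongDual ℝ E → E, Continuous h ∧
      ∀ v ∈ interior (effDom ψ), h (fderiv ℝ (realVal ψ) v) = v := by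
  classical
  rcases (interior (effDom ψ)).eq_empty_or_nonempty with he | ⟨v₀, hv₀⟩
  · exact ⟨fun _ => 0, continuous_const, by simp [he]⟩
  have : Nonempty E := ⟨0⟩
  set S := interior (effDom ψ)
  set F := fderiv ℝ (realVal ψ)
  have hinj : InjOn F S := fun u hu v hv huv => by
    have := hψ.norm_sub_le_norm_fderiv_sub hu hv
    rw [show fderiv ℝ (realVal ψ) u = fderiv ℝ (realVal ψ) v from huv, sub_self, norm_zero] at this
    exact sub_eq_zero.1 (norm_le_zero_iff.1 this)
  have hL : LipschitzOnWith 1 (Function.invFunOn F S) (F '' S) := by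
    refine LipschitzOnWith.of_dist_le_mul ?_
    rintro _ ⟨u, hu, rfl⟩ _ ⟨v, hv, rfl⟩
    rw [hinj.leftInvOn_invFunOn hu, hinj.leftInvOn_invFunOn hv, dist_eq_norm, dist_eq_norm]
    simpa using hψ.norm_sub_le_norm_fderiv_sub hu hv
  -- Extending to the whole dual space yields a measurable map without any information about the
  -- image of the gradient.
  obtain ⟨h, hh, heq⟩ := hL.extend_finite_dimension
  exact ⟨h, hh.continuous, fun v hv => by
    rw [← heq (mem_image_of_mem F hv), hinj.leftInvOn_invFunOn hv]⟩

/-- The iterates of mirror descent are adapted. -/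
lemma measurable_iterate [FiniteDimensional ℝ E] [MeasurableSpace E] [BorelSpace E]
    {Ω : Type*} {mΩ : MeasurableSpace Ω} (ℱ : Filtration ℕ mΩ) (hψ : IsMirrorMap ψ) {η : ℝ} {t : ℕ}
    {f : Ω → ℕ → E → ℝ} {w₀ : E} {g : ℕ → Ω → StrongDual ℝ E} {w : ℕ → Ω → E}
    (hg : ∀ i, 1 ≤ i → i ≤ t → Measurable[ℱ i] (g i))
    (h : ∀ ω, IsMirrorDescentRun ψ η t (f ω) w₀ (fun i => g i ω) (fun i => w i ω)) {i : ℕ}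
    (hi : i ≤ t) : Measurable[ℱ i] (w i) := by
  obtain ⟨k, hk, hinv⟩ := hψ.exists_continuous_leftInverse
  -- In dual coordinates the recursion is a plain sum, so each iterate is one fixed continuous
  -- function of past gradients.
  have e : w i = fun ω => k (fderiv ℝ (realVal ψ) w₀ - η • ∑ j ∈ Finset.range i, g (j + 1) ω) := by
    ext ω
    rw [← (h ω).fderiv_eq hψ hi, hinv _ ((h ω).mem_interior i hi)]
  rw [e]
  refine hk.measurable.comp (Measurable.const_sub (Measurable.const_smul ?_ η) _)
  refine Finset.measurable_sum _ fun j hj => ?_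
  have hj' := Finset.mem_range.1 hj
  exact (hg (j + 1) (by omega) (by omega)).mono (ℱ.mono (by omega)) le_rfl

end MirrorMaps

/-! ### Losses: measurability, local Lipschitz bounds, risk -/

section Losses

variable {ℓ : ℝ → ℝ → ℝ} {C₁ C₂ : ℝ}

lemma IsConvexLoss.nonneg (hℓ : IsConvexLoss ℓ) (y z : ℝ) : 0 ≤ ℓ y z := by
  obtain ⟨φ, -, h0, h | h⟩ := hℓ <;> rw [h] <;> exact h0 _

lemma abs_sgn (y : ℝ) : |sgn y| = 1 := by
  unfold sgn; split_ifs <;> simp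

lemma IsConvexLoss.measurable (hℓ : IsConvexLoss ℓ) : Measurable (fun p : ℝ × ℝ => ℓ p.1 p.2) := by
  obtain ⟨φ, hφ, -, h⟩ := hℓ
  have hc : Measurable φ := (continuousOn_univ.1 (hφ.continuousOn isOpen_univ)).measurable
  have hsgn : Measurable sgn := Measurable.ite measurableSet_Ici measurable_const measurable_const
  rcases h with h | h <;> simp only [h]
  · exact hc.comp ((hsgn.comp measurable_fst).mul measurable_snd)
  · exact hc.comp (measurable_fst.sub measurable_snd)

lemma IsConvexLoss.bounded (hℓ : IsConvexLoss ℓ) (r : ℝ) :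
    ∃ K, ∀ y z, |y| ≤ 1 → |z| ≤ r → ℓ y z ≤ K := by
  obtain ⟨φ, hφ, -, h⟩ := hℓ
  have hc : Continuous φ := continuousOn_univ.1 (hφ.continuousOn isOpen_univ)
  obtain ⟨K, hK⟩ := (isCompact_Icc (a := -(1 + r)) (b := 1 + r)).bddAbove_image hc.continuousOn
  refine ⟨K, fun y z hy hz => ?_⟩
  have hm : ∀ x, |x| ≤ 1 + r → φ x ≤ K := fun x hx => hK ⟨x, abs_le.1 hx, rfl⟩
  rcases h with h | h <;> rw [h] <;> apply hm
  · rw [abs_mul, abs_sgn]; linarith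
  · exact (abs_sub _ _).trans (by linarith)

/-- The constant involves only the first point `a`, since the subgradient is taken there; `b` may be
arbitrary. -/
lemma IsQuadraticallyBounded.sub_le (h : IsQuadraticallyBounded ℓ C₁ C₂) (y a b : ℝ) :
    ℓ y a - ℓ y b ≤ (C₁ + C₂ * (|y| + |a|)) * |a - b| := by
  obtain ⟨ℓ', h⟩ := h
  have h1 := (h y a).1 b
  have h2 : ℓ' y a * (a - b) ≤ (C₁ + C₂ * (|y| + |a|)) * |a - b| :=
    (le_abs_self _).trans (by rw [abs_mul]; gcongr; exact (h y a).2)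
  linarith

variable {E : Type*} [NormedAddCommGroup E] [NormedSpace ℝ E]

lemma pointLoss_sub_le (h : IsQuadraticallyBounded ℓ C₁ C₂) (hC₁ : 0 ≤ C₁) (hC₂ : 0 ≤ C₂)
    {z : DataPoint E} (hz : max ‖z.1‖ |z.2| ≤ 1) (u v : E) :
    pointLoss ℓ z u - pointLoss ℓ z v ≤ (C₁ + C₂ * (1 + ‖u‖)) * ‖u - v‖ := by
  obtain ⟨hx, hy⟩ := max_le_iff.1 hz
  have hn : ∀ u : E, |z.1 u| ≤ ‖u‖ := fun u =>
    (z.1.le_opNorm u).trans (mul_le_of_le_one_left (norm_nonneg u) hx)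
  refine (h.sub_le z.2 (z.1 u) (z.1 v)).trans ?_
  rw [← map_sub]
  gcongr
  exacts [hn u, hn _]

/-- Every subgradient satisfies the bound that a selection is assumed to satisfy. -/
lemma norm_subgradient_le (h : IsQuadraticallyBounded ℓ C₁ C₂) (hC₁ : 0 ≤ C₁) (hC₂ : 0 ≤ C₂)
    {z : DataPoint E} (hz : max ‖z.1‖ |z.2| ≤ 1) {v : E} {g : StrongDual ℝ E}
    (hg : IsSubgradient (pointLoss ℓ z) v g) : ‖g‖ ≤ C₁ + C₂ * (1 + ‖v‖) := by
  -- The subgradient inequality at v + εu bounds ε g(u) by a Lipschitz increment whose constant sits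
  -- at v + εu; ε → 0+ moves it to v.
  have hle : ∀ u : E, g u ≤ (C₁ + C₂ * (1 + ‖v‖)) * ‖u‖ := fun u => by
    have ht : Tendsto (fun ε : ℝ => (C₁ + C₂ * (1 + ‖v + ε • u‖)) * ‖u‖) (nhdsWithin 0 (Ioi 0))
        (nhds ((C₁ + C₂ * (1 + ‖v + (0 : ℝ) • u‖)) * ‖u‖)) :=
      Tendsto.mono_left (Continuous.tendsto (by fun_prop) 0) nhdsWithin_le_nhds
    rw [zero_smul, add_zero] at ht
    refine ge_of_tendsto ht ?_
    filter_upwards [self_mem_nhdsWithin] with ε (hε : 0 < ε)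
    have h1 := hg (v + ε • u)
    have h2 := pointLoss_sub_le h hC₁ hC₂ hz (v + ε • u) v
    rw [add_sub_cancel_left, map_smul, smul_eq_mul] at h1
    rw [add_sub_cancel_left, norm_smul, Real.norm_of_nonneg hε.le] at h2
    nlinarith
  refine g.opNorm_le_bound (by positivity) fun u => abs_le.2 ⟨?_, hle u⟩
  have := hle (-u)
  rw [map_neg, norm_neg] at this
  linarith

lemma measurable_pointLoss [FiniteDimensional ℝ E] [MeasurableSpace E] [BorelSpace E]
    (hℓ : IsConvexLoss ℓ) : Measurable (fun p : DataPoint E × E => pointLoss ℓ p.1 p.2) := by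
  have hc : Measurable (fun p : StrongDual ℝ E × E => p.1 p.2) :=
    (isBoundedBilinearMap_apply (𝕜 := ℝ) (E := E) (F := ℝ)).continuous.measurable
  exact hℓ.measurable.comp (f := fun p : DataPoint E × E => (p.1.2, p.1.1 p.2))
    ((measurable_snd.comp measurable_fst).prodMk
      (hc.comp ((measurable_fst.comp measurable_fst).prodMk measurable_snd)))

lemma integrable_pointLoss [FiniteDimensional ℝ E] (hℓ : IsConvexLoss ℓ)
    {π : Measure (DataPoint E)} [IsFiniteMeasure π] (hπ : ∀ᵐ z ∂π, max ‖z.1‖ |z.2| ≤ 1) (v : E) :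
    Integrable (fun z => pointLoss ℓ z v) π := by
  borelize E
  obtain ⟨K, hK⟩ := hℓ.bounded ‖v‖
  refine Integrable.of_bound
    ((measurable_pointLoss hℓ).comp measurable_prodMk_right).aestronglyMeasurable K ?_
  filter_upwards [hπ] with z hz
  obtain ⟨hx, hy⟩ := max_le_iff.1 hz
  have hp : 0 ≤ pointLoss ℓ z v := hℓ.nonneg _ _
  rw [Real.norm_of_nonneg hp]
  exact hK _ _ hy ((z.1.le_opNorm v).trans (mul_le_of_le_one_left (norm_nonneg v) hx))

lemma risk_nonneg (hℓ : IsConvexLoss ℓ) (π : Measure (DataPoint E)) (v : E) : 0 ≤ risk ℓ π v :=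
  integral_nonneg fun _ => hℓ.nonneg _ _

lemma risk_sub_le_excessRisk (hℓ : IsConvexLoss ℓ) (π : Measure (DataPoint E)) (ψ : E → EReal)
    (u : E) {v : E} (hv : v ∈ effDom ψ) : risk ℓ π u - risk ℓ π v ≤ excessRisk ℓ π ψ u := by
  -- Nonnegativity of the risk bounds the set below, so `sInf` is a true infimum and not the default
  -- value 0.
  refine sub_le_sub_left (csInf_le ⟨0, ?_⟩ (mem_image_of_mem _ hv)) _
  rintro _ ⟨x, -, rfl⟩
  exact risk_nonneg hℓ π x

end Losses

/-! ### Total variation controls integrals of bounded functions -/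

section TotalVariation

variable {α : Type*} [MeasurableSpace α] (P Q : Measure α)

lemma abs_measureReal_sub_le_tvDist [IsProbabilityMeasure P] [IsProbabilityMeasure Q] {A : Set α}
    (hA : MeasurableSet A) : |P.real A - Q.real A| ≤ tvDist P Q := by
  refine le_ciSup (f := fun A : {A : Set α // MeasurableSet A} => |P.real A - Q.real A|)
    ⟨1, ?_⟩ ⟨A, hA⟩
  rintro _ ⟨A, rfl⟩
  exact abs_sub_le_of_nonneg_of_le measureReal_nonneg measureReal_le_one measureReal_nonneg
    measureReal_le_one

/-- Layer-cake formula: f + M takes values in [0, 2M], so both integrals are integrals over (0, 2M]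
of superlevel-set masses, which differ pointwise by at most the distance. -/
lemma integral_sub_integral_le_tvDist [IsProbabilityMeasure P] [IsProbabilityMeasure Q] {f : α → ℝ}
    (hf : Measurable f) {M : ℝ} (hM : 0 ≤ M) (hb : ∀ x, |f x| ≤ M) :
    ∫ x, f x ∂P - ∫ x, f x ∂Q ≤ 2 * M * tvDist P Q := by
  have hi : ∀ ν : Measure α, IsProbabilityMeasure ν → Integrable f ν := fun ν _ =>
    Integrable.of_bound hf.aestronglyMeasurable M (ae_of_all _ hb)
  have hr : ∀ ν : Measure α, IsProbabilityMeasure ν →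
      ∫ x, f x ∂ν + M = ∫ s in Ioc 0 (2 * M), ν.real {a | s ≤ f a + M} := fun ν _ => by
    rw [← Integrable.integral_eq_integral_Ioc_meas_le (f := fun a => f a + M)
      ((hi ν inferInstance).add (integrable_const M)) (ae_of_all _ fun x => ?_)
      (ae_of_all _ fun x => ?_)]
    · rw [integral_add (hi ν inferInstance) (integrable_const M)]; simp
    · have := (abs_le.1 (hb x)).1
      simp only [Pi.zero_apply]; linarith
    · have := (abs_le.1 (hb x)).2
      linarith
  have hint : ∀ ν : Measure α, IsProbabilityMeasure ν →
      IntegrableOn (fun s => ν.real {a | s ≤ f a + M}) (Ioc 0 (2 * M)) := fun ν _ => by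
    have han : Antitone (fun s : ℝ => ν.real {a | s ≤ f a + M}) := fun s s' hs =>
      measureReal_mono (μ := ν) (show {a | s' ≤ f a + M} ⊆ {a | s ≤ f a + M} from
        fun a ha => hs.trans ha)
    exact (han.antitoneOn _).integrableOn_isCompact isCompact_Icc |>.mono_set Ioc_subset_Icc_self
  have h : ∫ x, f x ∂P - ∫ x, f x ∂Q = (∫ x, f x ∂P + M) - (∫ x, f x ∂Q + M) := by ring
  rw [h, hr P inferInstance, hr Q inferInstance, ← integral_sub (hint P inferInstance)
    (hint Q inferInstance)]
  calc _ ≤ ∫ _ in Ioc 0 (2 * M), tvDist P Q := by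
        refine integral_mono ((hint P inferInstance).sub (hint Q inferInstance))
          (integrable_const _) fun s => ?_
        exact (le_abs_self _).trans (abs_measureReal_sub_le_tvDist P Q
          (measurableSet_le measurable_const (hf.add_const M)))
    _ = 2 * M * tvDist P Q := by simp [hM]

end TotalVariation

/-! ### Disintegration along the conditional law -/

section Conditional

variable {Ω α : Type*} [MeasurableSpace α] [StandardBorelSpace α] [Nonempty α]
  {mΩ : MeasurableSpace Ω} (μ : Measure Ω)

instance [IsFiniteMeasure μ] (Y : Ω → α) (m : MeasurableSpace Ω) (ω : Ω) :
    IsProbabilityMeasure (condLaw μ Y m ω) := by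
  unfold condLaw; infer_instance

/-- Disintegration of an expectation along the conditional law. -/
lemma lintegral_condLaw [IsFiniteMeasure μ] {Y : Ω → α} (hY : Measurable Y) {m : MeasurableSpace Ω}
    (hm : m ≤ mΩ) {f : Ω → α → ENNReal} (hf : Measurable[m.prod inferInstance] (Function.uncurry f)) :
    ∫⁻ ω, f ω (Y ω) ∂μ = ∫⁻ ω, ∫⁻ z, f ω z ∂(condLaw μ Y m ω) ∂μ := by
  have hid : @Measurable Ω Ω mΩ m id := measurable_id'' hm
  have h := @compProd_map_condDistrib Ω Ω α _ _ _ mΩ μ _ id Y m hY.aemeasurable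
  have h1 := congrArg (fun ν => @lintegral _ (@Prod.instMeasurableSpace Ω α m _) ν
    (Function.uncurry f)) h
  rw [@Measure.lintegral_compProd _ _ m _ _ _ _ _ _ hf,
    @lintegral_map _ _ mΩ (@Prod.instMeasurableSpace Ω α m _) _ _ _ hf
      (hid.prodMk hY)] at h1
  rw [@lintegral_map _ _ mΩ m _ _ _ (@Measurable.lintegral_kernel_prod_right' _ _ m _ _ _ _ hf) hid]
    at h1
  exact h1.symm

end Conditional

/-! ### Concentration with lag τ -/

section Concentration

variable {Ω : Type*} {mΩ : MeasurableSpace Ω} (μ : Measure Ω)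

section ConditionalMGF

variable {α β : Type*} [MeasurableSpace α] [MeasurableSpace β]

/-- Hoeffding's lemma under a measure close to `π` in total variation. -/
lemma lintegral_exp_le_of_tvDist_le (κ π : Measure α) [IsProbabilityMeasure κ]
    [IsProbabilityMeasure π] {h : α → ℝ} (hh : Measurable h) {M : ℝ} (hM : 0 ≤ M)
    (hb : ∀ z, |h z| ≤ M) {ε : ℝ} (hε : tvDist κ π ≤ ε) {r : ℝ} (hr : 0 ≤ r) :
    ∫⁻ z, ENNReal.ofReal (Real.exp (r * (∫ x, h x ∂π - h z - 2 * M * ε))) ∂κ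
      ≤ ENNReal.ofReal (Real.exp (r ^ 2 * M ^ 2 / 2)) := by
  have hsub := hasSubgaussianMGF_of_mem_Icc (μ := κ) (X := fun z => -h z) (a := -M) (b := M)
    hh.neg.aemeasurable (ae_of_all _ fun z => ⟨by linarith [(abs_le.1 (hb z)).2],
      by linarith [(abs_le.1 (hb z)).1]⟩)
  have hmgf := hsub.mgf_le r
  have hint := hsub.integrable_exp_mul r
  have htv := integral_sub_integral_le_tvDist κ π hh.neg hM (fun z => by
    rw [Pi.neg_apply, abs_neg]; exact hb z)
  simp only [Pi.neg_apply, integral_neg] at htv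
  have hMε := mul_le_mul_of_nonneg_left hε (by positivity : 0 ≤ 2 * M)
  -- The term 2Mε pays for replacing the mean under π by the mean under κ, for which Hoeffding's
  -- lemma holds.
  calc _ ≤ ∫⁻ z, ENNReal.ofReal (Real.exp (r * (-h z - ∫ x, -h x ∂κ))) ∂κ := by
        refine lintegral_mono fun z => ENNReal.ofReal_le_ofReal (Real.exp_le_exp.2
          (mul_le_mul_of_nonneg_left ?_ hr))
        rw [integral_neg]
        linarith
    _ = ENNReal.ofReal (∫ z, Real.exp (r * (-h z - ∫ x, -h x ∂κ)) ∂κ) :=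
        (ofReal_integral_eq_lintegral_ofReal hint (ae_of_all _ fun z => (Real.exp_pos _).le)).symm
    _ ≤ _ := by
        refine ENNReal.ofReal_le_ofReal (hmgf.trans (le_of_eq ?_))
        congr 1
        rw [show M - -M = 2 * M by ring]
        simp only [NNReal.coe_pow, NNReal.coe_div, coe_nnnorm, NNReal.coe_ofNat]
        rw [Real.norm_of_nonneg (by positivity)]
        ring

/-- Testing against every `m`-measurable weight `W` expresses the conditional moment bound without
conditional expectations. Disintegration freezes `v` and `W`, leaving Hoeffding's lemma for a single
function of the data point. -/
lemma lintegral_mul_exp_le_of_condLaw [StandardBorelSpace α] [Nonempty α] [IsFiniteMeasure μ]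
    (π : Measure α) [IsProbabilityMeasure π] {m : MeasurableSpace Ω} (hm : m ≤ mΩ) {Y : Ω → α}
    (hY : Measurable[mΩ] Y) {v : Ω → β} (hv : Measurable[m] v) {H : α × β → ℝ} (hH : Measurable H)
    {M : ℝ} (hM : 0 ≤ M) (hb : ∀ p, |H p| ≤ M) {ε : ℝ}
    (hε : ∀ᵐ ω ∂μ, tvDist (condLaw μ Y m ω) π ≤ ε) {r : ℝ} (hr : 0 ≤ r) {W : Ω → ENNReal}
    (hW : Measurable[m] W) :
    ∫⁻ ω, W ω * ENNReal.ofReal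
        (Real.exp (r * (∫ x, H (x, v ω) ∂π - H (Y ω, v ω) - 2 * M * ε))) ∂μ
      ≤ ENNReal.ofReal (Real.exp (r ^ 2 * M ^ 2 / 2)) * ∫⁻ ω, W ω ∂μ := by
  have hbar : Measurable (fun b : β => ∫ x, H (x, b) ∂π) :=
    (hH.stronglyMeasurable.integral_prod_left' (μ := π)).measurable
  have hsec : ∀ b, Measurable fun x => H (x, b) := fun b => hH.comp measurable_prodMk_right
  have hfst : @Measurable _ _ (m.prod inferInstance) m (Prod.fst : Ω × α → Ω) :=
    @measurable_fst Ω α m _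
  have hsnd : @Measurable _ _ (m.prod inferInstance) _ (Prod.snd : Ω × α → α) :=
    @measurable_snd Ω α m _
  rw [lintegral_condLaw μ hY hm (f := fun ω z => W ω * ENNReal.ofReal
    (Real.exp (r * (∫ x, H (x, v ω) ∂π - H (z, v ω) - 2 * M * ε))))]
  · rw [← lintegral_const_mul _ (hW.mono hm le_rfl)]
    refine lintegral_mono_ae ?_
    filter_upwards [hε] with ω hω
    rw [lintegral_const_mul _ (by have := hsec (v ω); fun_prop), mul_comm (W ω)]
    gcongr
    exact lintegral_exp_le_of_tvDist_le _ π (hsec (v ω)) hM (fun z => hb _) hω hr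
  · refine Measurable.mul (hW.comp hfst) ?_
    refine ENNReal.measurable_ofReal.comp (Real.measurable_exp.comp ?_)
    refine Measurable.const_mul (Measurable.sub_const (Measurable.sub ?_ ?_) _) _
    · exact hbar.comp (hv.comp hfst)
    · exact hH.comp (hsnd.prodMk (hv.comp hfst))

end ConditionalMGF

lemma card_filter_mod_mul_le {τ : ℕ} (N r : ℕ) :
    ((Finset.range N).filter (fun s => s % τ = r)).card * τ ≤ N - 1 + τ := by
  rcases τ.eq_zero_or_pos with rfl | hτ
  · simp
  have h : ((Finset.range N).filter (fun s => s % τ = r)).card ≤ (N - 1) / τ + 1 := by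
    rw [← Finset.card_range ((N - 1) / τ + 1)]
    refine Finset.card_le_card_of_injOn (fun s => s / τ) (fun s hs => ?_) (fun a ha b hb hab => ?_)
    · have := Finset.mem_range.1 (Finset.mem_filter.1 (Finset.mem_coe.1 hs)).1
      exact Finset.mem_coe.2 (Finset.mem_range.2
        (Nat.lt_succ_of_le (Nat.div_le_div_right (by omega))))
    · have ha' := (Finset.mem_filter.1 (Finset.mem_coe.1 ha)).2
      have hb' := (Finset.mem_filter.1 (Finset.mem_coe.1 hb)).2
      have hab' : a / τ = b / τ := hab
      rw [← Nat.div_add_mod a τ, ← Nat.div_add_mod b τ, ha', hb', hab']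
  calc _ ≤ ((N - 1) / τ + 1) * τ := Nat.mul_le_mul_right _ h
    _ ≤ _ := by rw [add_mul, one_mul]; exact Nat.add_le_add_right (Nat.div_mul_le_self _ _) _

variable {ℱ : Filtration ℕ mΩ} {τ t : ℕ} {Y : ℕ → Ω → ℝ}

/-- Exponential moments of a lagged supermartingale-difference sequence, along a residue class. -/
lemma lintegral_exp_sum_filter_mod_le [IsProbabilityMeasure μ]
    (hY : ∀ s, s + τ ≤ t → Measurable[ℱ (s + τ)] (Y s)) {r c : ℝ}
    (hmgf : ∀ s, s + τ ≤ t → ∀ W : Ω → ENNReal, Measurable[ℱ s] W →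
      ∫⁻ ω, W ω * ENNReal.ofReal (Real.exp (r * Y s ω)) ∂μ
        ≤ ENNReal.ofReal (Real.exp c) * ∫⁻ ω, W ω ∂μ) (k : ℕ) {N : ℕ} (hN : ∀ s < N, s + τ ≤ t) :
    ∫⁻ ω, ENNReal.ofReal
        (Real.exp (r * ∑ s ∈ (Finset.range N).filter (fun s => s % τ = k), Y s ω)) ∂μ
      ≤ ENNReal.ofReal
        (Real.exp (((Finset.range N).filter (fun s => s % τ = k)).card * c)) := by
  induction N with
  | zero => simp
  | succ N ih =>
    have ih' := ih fun s hs => hN s (by omega)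
    by_cases hk : N % τ = k
    · have hnot : N ∉ (Finset.range N).filter (fun s => s % τ = k) := by simp
      simp only [Finset.range_add_one, Finset.filter_insert, hk, if_true,
        Finset.sum_insert hnot, Finset.card_insert_of_notMem hnot]
      have hmeas : Measurable[ℱ N] fun ω => ENNReal.ofReal
          (Real.exp (r * ∑ s ∈ (Finset.range N).filter (fun s => s % τ = k), Y s ω)) := by
        refine ENNReal.measurable_ofReal.comp (Real.measurable_exp.comp (Measurable.const_mul
          (Finset.measurable_sum _ fun s hs => ?_) _))
        obtain ⟨hs1, hs2⟩ := Finset.mem_filter.1 hs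
        have hs1 := Finset.mem_range.1 hs1
        -- Distinct indices in one residue class are at least τ apart, so the earlier terms are
        -- already ℱ_N-measurable.
        have hle : s + τ ≤ N := by
          have hd : τ ∣ N - s := (Nat.modEq_iff_dvd' hs1.le).1 (hs2.trans hk.symm)
          have := Nat.le_of_dvd (by omega) hd
          omega
        exact (hY s (hN s (by omega))).mono (ℱ.mono hle) le_rfl
      have h := hmgf N (hN N (by omega)) _ hmeas
      calc _ = _ := by
            refine lintegral_congr fun ω => ?_
            rw [← ENNReal.ofReal_mul (Real.exp_pos _).le, ← Real.exp_add]
            congr 2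
            ring
        _ ≤ _ := h
        _ ≤ _ := mul_le_mul_right ih' _
        _ = _ := by
            rw [← ENNReal.ofReal_mul (Real.exp_pos _).le, ← Real.exp_add]
            congr 2
            push_cast
            ring
    · simpa only [Finset.range_add_one, Finset.filter_insert, hk, if_false] using ih'

/-- A maximal Azuma–Hoeffding inequality for sequences with lag `τ`. -/
lemma one_sub_le_measureReal_forall_sum_le [IsProbabilityMeasure μ] (ht : 1 ≤ t) (hτ : 1 ≤ τ)
    (hY : ∀ s, s + τ ≤ t → Measurable[ℱ (s + τ)] (Y s)) {M : ℝ} (hM : 0 < M)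
    (hmgf : ∀ s, s + τ ≤ t → ∀ r : ℝ, 0 ≤ r → ∀ W : Ω → ENNReal, Measurable[ℱ s] W →
      ∫⁻ ω, W ω * ENNReal.ofReal (Real.exp (r * Y s ω)) ∂μ
        ≤ ENNReal.ofReal (Real.exp (r ^ 2 * M ^ 2 / 2)) * ∫⁻ ω, W ω ∂μ)
    {δ : ℝ} (hδ : 0 < δ) (hδ1 : δ < 1) :
    1 - (t : ℝ) * τ * δ ≤ μ.real {ω | ∀ i, 1 ≤ i → i ≤ t →
      ∑ s ∈ Finset.range (i + 1 - τ), Y s ω ≤ M * √(2 * (t * τ * Real.log (1 / δ)))} := by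
  have ht0 : (0 : ℝ) < t := by exact_mod_cast ht
  have hτ0 : (0 : ℝ) < τ := by exact_mod_cast hτ
  have hlog : 0 < Real.log (1 / δ) := Real.log_pos (by rw [lt_div_iff₀ hδ]; linarith)
  set a := M * √(2 * (t * τ * Real.log (1 / δ))) with ha
  have ha0 : 0 < a := by positivity
  have ha2 : a ^ 2 = 2 * M ^ 2 * t * τ * Real.log (1 / δ) := by
    rw [ha, mul_pow, Real.sq_sqrt (by positivity)]; ring
  set S : ℕ → ℕ → Ω → ℝ := fun i k ω =>
    ∑ s ∈ (Finset.range (i + 1 - τ)).filter (fun s => s % τ = k), Y s ω with hS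
  have hlt : ∀ i ≤ t, ∀ s < i + 1 - τ, s + τ ≤ t := fun i hi s hs => by omega
  have htail : ∀ i ∈ Finset.Icc 1 t, ∀ k, μ.real {ω | a / τ ≤ S i k ω} ≤ δ := by
    intro i hi k
    obtain ⟨hi1, hit⟩ := Finset.mem_Icc.1 hi
    set n := ((Finset.range (i + 1 - τ)).filter (fun s => s % τ = k)).card with hn
    -- Minimizer of the Chernoff exponent n r²M²/2 - ra/τ at the largest admissible class size n =
    -- t/τ; the minimum is log δ.
    set r := a / (M ^ 2 * t) with hr
    have hr0 : 0 ≤ r := by positivity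
    have hcard : (n : ℝ) * τ ≤ t := by
      have h1 := card_filter_mod_mul_le (τ := τ) (i + 1 - τ) k
      rw [← hn] at h1
      have h2 : n * τ ≤ t := by
        -- When i < τ the subtraction truncates to 0 and the counting bound would give only τ,
        -- possibly above t.
        rcases Nat.eq_zero_or_pos (i + 1 - τ) with h0 | h0
        · rw [hn, h0]; simp
        · omega
      exact_mod_cast h2
    have hexp := lintegral_exp_sum_filter_mod_le μ hY (r := r) (c := r ^ 2 * M ^ 2 / 2)
      (fun s hs W hW => hmgf s hs r hr0 W hW) k (hlt i hit)
    rw [← hn] at hexp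
    have hmS : Measurable (S i k) := Finset.measurable_sum _ fun s hs =>
      (hY s (hlt i hit s (Finset.mem_range.1 (Finset.mem_filter.1 hs).1))).mono (ℱ.le _) le_rfl
    have hmark := meas_ge_le_lintegral_div (μ := μ)
      (f := fun ω => ENNReal.ofReal (Real.exp (r * S i k ω)))
      (by fun_prop) (ε := ENNReal.ofReal (Real.exp (r * (a / τ))))
      (by simp [Real.exp_pos]) ENNReal.ofReal_ne_top
    have hle : μ {ω | a / τ ≤ S i k ω} ≤ ENNReal.ofReal δ := by
      calc _ ≤ _ := measure_mono fun ω (hω : a / τ ≤ S i k ω) =>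
            ENNReal.ofReal_le_ofReal (Real.exp_le_exp.2 (mul_le_mul_of_nonneg_left hω hr0))
        _ ≤ _ := hmark
        _ ≤ _ := ENNReal.div_le_div_right hexp _
        _ = ENNReal.ofReal (Real.exp (n * (r ^ 2 * M ^ 2 / 2) - r * (a / τ))) := by
            rw [← ENNReal.ofReal_div_of_pos (Real.exp_pos _), ← Real.exp_sub]
        _ ≤ ENNReal.ofReal δ := by
            refine ENNReal.ofReal_le_ofReal ?_
            rw [← Real.exp_log hδ]
            refine Real.exp_le_exp.2 ?_
            have e1 : (n : ℝ) ≤ t / τ := by rwa [le_div_iff₀ hτ0]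
            have e2 : (n : ℝ) * (r ^ 2 * M ^ 2 / 2) ≤ t / τ * (r ^ 2 * M ^ 2 / 2) := by gcongr
            have e3 : (t : ℝ) / τ * (r ^ 2 * M ^ 2 / 2) - r * (a / τ)
                = -(a ^ 2 / (2 * M ^ 2 * t * τ)) := by
              rw [hr]; field_simp; ring
            have e4 : a ^ 2 / (2 * M ^ 2 * t * τ) = -Real.log δ := by
              rw [ha2, one_div, Real.log_inv]; field_simp
            linarith
    exact ENNReal.toReal_le_of_le_ofReal hδ.le hle
  set G := {ω | ∀ i, 1 ≤ i → i ≤ t → ∑ s ∈ Finset.range (i + 1 - τ), Y s ω ≤ a} with hG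
  -- A sum of τ class sums can exceed a only if some class sum is at least a/τ.
  have hcompl : Gᶜ ⊆ ⋃ p ∈ Finset.Icc 1 t ×ˢ Finset.range τ, {ω | a / τ ≤ S p.1 p.2 ω} := by
    intro ω hω
    simp only [hG, mem_compl_iff, mem_ofPred_eq, not_forall, not_le] at hω
    obtain ⟨i, hi1, hit, hlt'⟩ := hω
    by_contra hno
    simp only [mem_iUnion, mem_ofPred_eq, not_exists, not_le, Prod.forall, Finset.mem_product,
      Finset.mem_Icc, Finset.mem_range] at hno
    have hsum : ∑ s ∈ Finset.range (i + 1 - τ), Y s ω = ∑ k ∈ Finset.range τ, S i k ω :=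
      (Finset.sum_fiberwise_of_maps_to (fun s _ => Finset.mem_range.2 (Nat.mod_lt s hτ)) _).symm
    have : ∑ k ∈ Finset.range τ, S i k ω ≤ ∑ _k ∈ Finset.range τ, a / τ :=
      Finset.sum_le_sum fun k hk => (hno i k ⟨⟨hi1, hit⟩, Finset.mem_range.1 hk⟩).le
    rw [Finset.sum_const, Finset.card_range, nsmul_eq_mul, mul_div_cancel₀ _ hτ0.ne'] at this
    linarith
  have hGc : μ.real Gᶜ ≤ t * τ * δ := by
    calc _ ≤ _ := measureReal_mono hcompl (measure_ne_top _ _)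
      _ ≤ _ := measureReal_biUnion_finset_le _ _
      _ ≤ ∑ _p ∈ Finset.Icc 1 t ×ˢ Finset.range τ, δ :=
          Finset.sum_le_sum fun p hp => htail _ (Finset.mem_product.1 hp).1 _
      _ = _ := by simp
  have h1 : 1 ≤ μ.real G + μ.real Gᶜ := by
    rw [← probReal_univ (μ := μ), ← union_compl_self G]
    exact measureReal_union_le _ _
  linarith

end Concentration

/-! ### Regret on a good path -/

section Regret

/-- The first τ - 1 terms have no predecessor at lag τ and are bounded crudely; the others are
compared with `Y`. The factor `min i τ` is at most √(tτ), as the step size requires. -/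
lemma sum_range_le_of_lag {A Y : ℕ → ℝ} {a b : ℝ} (ha0 : 0 ≤ a) (hb0 : 0 ≤ b) {i τ : ℕ} (hτ : 1 ≤ τ)
    (ha : ∀ j < i, A j ≤ a) (hb : ∀ s < i + 1 - τ, A (s + (τ - 1)) ≤ Y s + b) :
    ∑ j ∈ Finset.range i, A j
      ≤ (min i τ : ℕ) * a + ∑ s ∈ Finset.range (i + 1 - τ), Y s + i * b := by
  rcases lt_or_ge i τ with h | h
  · have h1 : ∑ j ∈ Finset.range i, A j ≤ i * a :=
      (Finset.sum_le_sum fun j hj => ha j (Finset.mem_range.1 hj)).trans (by simp)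
    rw [min_eq_left h.le, show i + 1 - τ = 0 by omega, Finset.sum_range_zero]
    have : 0 ≤ (i : ℝ) * b := by positivity
    linarith
  · have h1 : ∑ j ∈ Finset.range (τ - 1), A j ≤ τ * a :=
      calc _ ≤ ∑ _j ∈ Finset.range (τ - 1), a :=
            Finset.sum_le_sum fun j hj => ha j (by have := Finset.mem_range.1 hj; omega)
        _ = ((τ - 1 : ℕ) : ℝ) * a := by simp
        _ ≤ _ := by gcongr; omega
    have h2 : ∑ s ∈ Finset.range (i + 1 - τ), A (s + (τ - 1))
        ≤ ∑ s ∈ Finset.range (i + 1 - τ), Y s + i * b :=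
      calc _ ≤ ∑ s ∈ Finset.range (i + 1 - τ), (Y s + b) :=
            Finset.sum_le_sum fun s hs => hb s (Finset.mem_range.1 hs)
        _ = ∑ s ∈ Finset.range (i + 1 - τ), Y s + ((i + 1 - τ : ℕ) : ℝ) * b := by
            simp [Finset.sum_add_distrib]
        _ ≤ _ := by gcongr; omega
    have h3 : ∑ j ∈ Finset.range i, A j = ∑ j ∈ Finset.range (τ - 1), A j
        + ∑ s ∈ Finset.range (i + 1 - τ), A (s + (τ - 1)) := by
      rw [show Finset.range i = Finset.range (τ - 1 + (i + 1 - τ)) by congr 1; omega,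
        Finset.sum_range_add]
      simp only [add_comm]
    rw [min_eq_right h, h3]
    linarith

variable {E : Type*} [NormedAddCommGroup E] [NormedSpace ℝ E] {ψ : E → EReal}
  {ℓ : ℝ → ℝ → ℝ} {C₁ C₂ : ℝ} {wref w₀ : E}

lemma one_le_radius : 1 ≤ radius ψ C₂ wref w₀ := le_max_left _ _

lemma sixteen_mul_bregman_le (h : 0 ≤ bregman ψ wref w₀) :
    16 * bregman ψ wref w₀ ≤ radius ψ C₂ wref w₀ ^ 2 := by
  have h1 : 4 * √(bregman ψ wref w₀) ≤ radius ψ C₂ wref w₀ :=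
    (le_max_right _ _).trans (le_max_right _ _)
  have h2 := pow_le_pow_left₀ (by positivity) h1 2
  rw [mul_pow, Real.sq_sqrt h] at h2
  linarith

/-- A Lipschitz constant of the point losses on the ball of radius `radius ψ C₂ wref w₀` about
`wref`. -/
def lipConst (ψ : E → EReal) (C₁ C₂ : ℝ) (wref w₀ : E) : ℝ :=
  4 * max 1 (max C₁ C₂) * radius ψ C₂ wref w₀

lemma lipConst_pos : 0 < lipConst ψ C₁ C₂ wref w₀ := by
  have h1 : 1 ≤ radius ψ C₂ wref w₀ := one_le_radius
  have h2 : 1 ≤ max 1 (max C₁ C₂) := le_max_left _ _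
  unfold lipConst
  positivity

/-- The sum is at most C + C + 2CB ≤ 4CB. The norm of `wref` enters only through C₂, hence the
indicator in `radius`. -/
lemma le_lipConst (hC₂ : 0 ≤ C₂) {v : E} (hv : ‖v - wref‖ ≤ radius ψ C₂ wref w₀) :
    C₁ + C₂ * (1 + ‖v‖) ≤ lipConst ψ C₁ C₂ wref w₀ := by
  unfold lipConst
  set B := radius ψ C₂ wref w₀ with hB
  set C := max 1 (max C₁ C₂)
  have hB1 : 1 ≤ B := one_le_radius
  have hC : 1 ≤ C := le_max_left _ _
  have h1 : C₁ ≤ C := (le_max_left _ _).trans (le_max_right _ _)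
  have h2 : C₂ ≤ C := (le_max_right _ _).trans (le_max_right _ _)
  have hCB : C ≤ C * B := le_mul_of_one_le_right (by linarith) hB1
  rcases hC₂.eq_or_lt with h0 | h0
  · rw [← h0]; linarith
  have hw : ‖wref‖ ≤ B := by
    have : (if 0 < C₂ then ‖wref‖ else 0) ≤ B := (le_max_left _ _).trans (le_max_right _ _)
    rwa [if_pos h0] at this
  have hv' : ‖v‖ ≤ 2 * B := by
    have := norm_le_norm_add_norm_sub' v wref
    linarith
  have h3 : C₂ * ‖v‖ ≤ C * (2 * B) := by gcongr
  linarith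

lemma pointLoss_sub_le_lipConst (h : IsQuadraticallyBounded ℓ C₁ C₂) (hC₁ : 0 ≤ C₁) (hC₂ : 0 ≤ C₂)
    {z : DataPoint E} (hz : max ‖z.1‖ |z.2| ≤ 1) {u : E}
    (hu : ‖u - wref‖ ≤ radius ψ C₂ wref w₀) (v : E) :
    pointLoss ℓ z u - pointLoss ℓ z v ≤ lipConst ψ C₁ C₂ wref w₀ * ‖u - v‖ :=
  (pointLoss_sub_le h hC₁ hC₂ hz u v).trans
    (mul_le_mul_of_nonneg_right (le_lipConst hC₂ hu) (norm_nonneg _))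

lemma risk_sub_le_lipConst [FiniteDimensional ℝ E] (hℓ : IsConvexLoss ℓ)
    (h : IsQuadraticallyBounded ℓ C₁ C₂) (hC₁ : 0 ≤ C₁) (hC₂ : 0 ≤ C₂)
    {π : Measure (DataPoint E)} [IsProbabilityMeasure π] (hπ : ∀ᵐ z ∂π, max ‖z.1‖ |z.2| ≤ 1)
    {u : E} (hu : ‖u - wref‖ ≤ radius ψ C₂ wref w₀) (v : E) :
    risk ℓ π u - risk ℓ π v ≤ lipConst ψ C₁ C₂ wref w₀ * ‖u - v‖ := by
  unfold risk
  have hu' := integrable_pointLoss hℓ hπ u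
  have hv' := integrable_pointLoss hℓ hπ v
  rw [← integral_sub hu' hv']
  calc _ ≤ ∫ _, lipConst ψ C₁ C₂ wref w₀ * ‖u - v‖ ∂π := by
        refine integral_mono_ae (hu'.sub hv') (integrable_const _) ?_
        filter_upwards [hπ] with z hz using pointLoss_sub_le_lipConst h hC₁ hC₂ hz hu v
    _ = _ := by simp

/-- The loss relative to `wref`, set to zero for large data and away from `wref`. -/
def clippedLoss (ℓ : ℝ → ℝ → ℝ) (wref : E) (B : ℝ) (p : DataPoint E × E) : ℝ :=
  if max ‖p.1.1‖ |p.1.2| ≤ 1 ∧ ‖p.2 - wref‖ ≤ B then pointLoss ℓ p.1 p.2 - pointLoss ℓ p.1 wref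
  else 0

lemma clippedLoss_of_le {B : ℝ} {z : DataPoint E} {v : E} (hz : max ‖z.1‖ |z.2| ≤ 1)
    (hv : ‖v - wref‖ ≤ B) :
    clippedLoss ℓ wref B (z, v) = pointLoss ℓ z v - pointLoss ℓ z wref := if_pos ⟨hz, hv⟩

lemma measurable_clippedLoss [FiniteDimensional ℝ E] [MeasurableSpace E] [BorelSpace E]
    (hℓ : IsConvexLoss ℓ) (wref : E) (B : ℝ) : Measurable (clippedLoss ℓ wref B) := by
  have h := measurable_pointLoss (E := E) hℓ
  have h1 : Measurable fun p : DataPoint E × E => max ‖p.1.1‖ |p.1.2| :=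
    measurable_fst.fst.norm.max (continuous_abs.measurable.comp measurable_fst.snd)
  have h2 : Measurable fun p : DataPoint E × E => ‖p.2 - wref‖ :=
    (measurable_snd.sub_const wref).norm
  refine Measurable.ite (MeasurableSet.inter ?_ ?_) (h.sub ?_) measurable_const
  · exact measurableSet_le h1 measurable_const
  · exact measurableSet_le h2 measurable_const
  · exact h.comp (measurable_fst.prodMk measurable_const)

lemma abs_clippedLoss_le (h : IsQuadraticallyBounded ℓ C₁ C₂) (hC₁ : 0 ≤ C₁) (hC₂ : 0 ≤ C₂)
    (p : DataPoint E × E) : |clippedLoss ℓ wref (radius ψ C₂ wref w₀) p|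
      ≤ lipConst ψ C₁ C₂ wref w₀ * radius ψ C₂ wref w₀ := by
  have hB : 1 ≤ radius ψ C₂ wref w₀ := one_le_radius
  have hG : 0 < lipConst ψ C₁ C₂ wref w₀ := lipConst_pos
  unfold clippedLoss
  split_ifs with hp
  · have h1 := pointLoss_sub_le_lipConst (wref := wref) (w₀ := w₀) (ψ := ψ) h hC₁ hC₂ hp.1 hp.2 wref
    have h2 := pointLoss_sub_le_lipConst (wref := wref) (w₀ := w₀) (ψ := ψ) h hC₁ hC₂ hp.1
      (u := wref) (by rw [sub_self, norm_zero]; linarith) p.2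
    rw [norm_sub_rev] at h2
    have h3 := mul_le_mul_of_nonneg_left hp.2 hG.le
    rw [abs_le]
    constructor <;> linarith
  · rw [abs_zero]; positivity

lemma integral_clippedLoss [FiniteDimensional ℝ E] (hℓ : IsConvexLoss ℓ)
    {π : Measure (DataPoint E)} [IsProbabilityMeasure π] (hπ : ∀ᵐ z ∂π, max ‖z.1‖ |z.2| ≤ 1)
    {B : ℝ} {v : E} (hv : ‖v - wref‖ ≤ B) :
    ∫ z, clippedLoss ℓ wref B (z, v) ∂π = risk ℓ π v - risk ℓ π wref := by
  unfold risk
  rw [← integral_sub (integrable_pointLoss hℓ hπ v) (integrable_pointLoss hℓ hπ wref)]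
  refine integral_congr_ae ?_
  filter_upwards [hπ] with z hz using clippedLoss_of_le hz hv

variable {η : ℝ} {t : ℕ} {z : ℕ → DataPoint E} {g : ℕ → StrongDual ℝ E} {w : ℕ → E}

lemma IsMirrorDescentRun.norm_subgradient_le_lipConst
    (hrun : IsMirrorDescentRun ψ η t (fun i => pointLoss ℓ (z i)) w₀ g w)
    (h : IsQuadraticallyBounded ℓ C₁ C₂) (hC₁ : 0 ≤ C₁) (hC₂ : 0 ≤ C₂)
    (hz : ∀ i, 1 ≤ i → i ≤ t → max ‖(z i).1‖ |(z i).2| ≤ 1) {i : ℕ} (hi : i < t)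
    (hw : ‖w i - wref‖ ≤ radius ψ C₂ wref w₀) : ‖g (i + 1)‖ ≤ lipConst ψ C₁ C₂ wref w₀ :=
  (norm_subgradient_le h hC₁ hC₂ (hz (i + 1) (by omega) hi) (hrun.subgradient i hi)).trans
    (le_lipConst hC₂ hw)

/-- The regret bound of mirror descent. -/
lemma IsMirrorDescentRun.bregman_add_sum_le
    (hrun : IsMirrorDescentRun ψ η t (fun i => pointLoss ℓ (z i)) w₀ g w) (hψ : IsMirrorMap ψ)
    (hη : 0 ≤ η) {G : ℝ} {i : ℕ} (hi : i ≤ t) (hg : ∀ j < i, ‖g (j + 1)‖ ≤ G) :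
    bregman ψ wref (w i)
        + η * ∑ j ∈ Finset.range i, (pointLoss ℓ (z (j + 1)) (w j) - pointLoss ℓ (z (j + 1)) wref)
      ≤ bregman ψ wref w₀ + i * (η ^ 2 * G ^ 2 / 2) := by
  induction i with
  | zero => simp [hrun.start]
  | succ i ih =>
    have ih' := ih (by omega) fun j hj => hg j (by omega)
    have h1 := (hrun.step i hi).bregman_le hψ hη (u := wref) (hrun.mem_interior i (by omega))
      (hrun.mem_interior _ hi)
    have h2 := mul_le_mul_of_nonneg_left (hrun.subgradient i hi wref) hη
    have h3 : η ^ 2 * ‖g (i + 1)‖ ^ 2 / 2 ≤ η ^ 2 * G ^ 2 / 2 := by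
      have := hg i (by omega)
      gcongr
    rw [Finset.sum_range_succ]
    push_cast
    linarith

lemma IsMirrorDescentRun.norm_sub_le
    (hrun : IsMirrorDescentRun ψ η t (fun i => pointLoss ℓ (z i)) w₀ g w) (hψ : IsMirrorMap ψ)
    (hη : 0 ≤ η) {G : ℝ} {s n : ℕ} (hn : s + n ≤ t) (hg : ∀ j < s + n, ‖g (j + 1)‖ ≤ G) :
    ‖w (s + n) - w s‖ ≤ n * (η * G) := by
  induction n with
  | zero => simp
  | succ n ih =>
    have ih' := ih (by omega) fun j hj => hg j (by omega)
    have h1 := (hrun.step (s + n) (by omega)).norm_sub_le hψ hη (hrun.mem_interior _ (by omega))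
      (hrun.mem_interior _ (by omega))
    have h2 := mul_le_mul_of_nonneg_left (hg (s + n) (by omega)) hη
    have h3 := norm_sub_le_norm_sub_add_norm_sub (w (s + n + 1)) (w (s + n)) (w s)
    rw [← add_assoc]
    push_cast
    linarith

/-- Here δ ≤ 1/2 is used: log(1/δ) ≥ log 2 ≥ 1/2. Terms of order √(tτ) can then be absorbed by the
step size. -/
lemma sqrt_le_two_mul_sqrt_mul_log {n δ : ℝ} (hn : 0 ≤ n) (hδ : 0 < δ) (hδ' : δ ≤ 1 / 2) :
    √n ≤ 2 * √(n * Real.log (1 / δ)) := by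
  have hlog : 1 / 2 ≤ Real.log (1 / δ) := by
    refine (by linarith [Real.log_two_gt_d9] : (1 : ℝ) / 2 ≤ Real.log 2).trans
      (Real.log_le_log two_pos ?_)
    rw [le_div_iff₀ hδ]; linarith
  rw [show (2 : ℝ) = √4 by rw [show (4 : ℝ) = 2 ^ 2 by norm_num, Real.sqrt_sq two_pos.le],
    ← Real.sqrt_mul (by norm_num)]
  refine Real.sqrt_le_sqrt ?_
  nlinarith [mul_le_mul_of_nonneg_left hlog hn]

set_option maxHeartbeats 800000 in
/-- The deterministic part: on a path with bounded data along which the lagged fluctuations are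
controlled, the iterates stay near `wref` and have small regret. -/
lemma IsMirrorDescentRun.bregman_add_regret_le [FiniteDimensional ℝ E]
    (hrun : IsMirrorDescentRun ψ η t (fun i => pointLoss ℓ (z i)) w₀ g w) (hψ : IsMirrorMap ψ)
    (hℓ : IsConvexLoss ℓ) (h : IsQuadraticallyBounded ℓ C₁ C₂) (hC₁ : 0 ≤ C₁) (hC₂ : 0 ≤ C₂)
    (ht : 1 ≤ t) {τ : ℕ} (hτ : 1 ≤ τ)
    (hz : ∀ i, 1 ≤ i → i ≤ t → max ‖(z i).1‖ |(z i).2| ≤ 1)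
    {π : Measure (DataPoint E)} [IsProbabilityMeasure π] (hπ : ∀ᵐ z ∂π, max ‖z.1‖ |z.2| ≤ 1)
    (hwref : wref ∈ effDom ψ)
    (hexcess : excessRisk ℓ π ψ wref ≤ bregman ψ wref w₀ / √(t : ℝ))
    {δ : ℝ} (hδ : 0 < δ) (hδ' : δ ≤ 1 / 2) (hη : 0 < η)
    (hη' : η ≤ 1 / (4096 * max 1 (max C₁ C₂) * √((t : ℝ) * τ * Real.log (1 / δ))))
    (hconc : ∀ i, 1 ≤ i → i ≤ t → ∑ s ∈ Finset.range (i + 1 - τ),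
        (∫ x, clippedLoss ℓ wref (radius ψ C₂ wref w₀) (x, w s) ∂π
          - clippedLoss ℓ wref (radius ψ C₂ wref w₀) (z (s + τ), w s)
          - 2 * (lipConst ψ C₁ C₂ wref w₀ * radius ψ C₂ wref w₀) * (1 / √(t : ℝ)))
      ≤ lipConst ψ C₁ C₂ wref w₀ * radius ψ C₂ wref w₀
          * √(2 * ((t : ℝ) * τ * Real.log (1 / δ))))
    {i : ℕ} (hi : i ≤ t) :
    bregman ψ wref (w i) + η * ∑ j ∈ Finset.range i, (risk ℓ π (w j) - risk ℓ π wref)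
      ≤ radius ψ C₂ wref w₀ ^ 2 / 8 := by
  have hw₀ : w₀ ∈ interior (effDom ψ) := hrun.start ▸ hrun.mem_interior 0 (by omega)
  have hD0 : 0 ≤ bregman ψ wref w₀ :=
    le_trans (by positivity) (hψ.half_sq_norm_le_bregman hwref hw₀)
  have hD16 := sixteen_mul_bregman_le (C₂ := C₂) hD0
  have hB1 : 1 ≤ radius ψ C₂ wref w₀ := one_le_radius
  have hG0 : 0 < lipConst ψ C₁ C₂ wref w₀ := lipConst_pos
  have hgrad := fun j (hj : j < t) => hrun.norm_subgradient_le_lipConst (wref := wref) h hC₁ hC₂ hz hj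
  have hlip := fun (x : DataPoint E) (hx : max ‖x.1‖ |x.2| ≤ 1) u =>
    pointLoss_sub_le_lipConst (ψ := ψ) (wref := wref) (w₀ := w₀) (u := u) h hC₁ hC₂ hx
  have hrisk := fun u =>
    risk_sub_le_lipConst (ψ := ψ) (wref := wref) (w₀ := w₀) (u := u) hℓ h hC₁ hC₂ hπ
  have hGdef : lipConst ψ C₁ C₂ wref w₀ = 4 * max 1 (max C₁ C₂) * radius ψ C₂ wref w₀ := rfl
  set B := radius ψ C₂ wref w₀
  set G := lipConst ψ C₁ C₂ wref w₀
  set C := max 1 (max C₁ C₂)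
  set q := √((t : ℝ) * τ * Real.log (1 / δ)) with hq
  set p := √((t : ℝ) * τ) with hp
  have hC1 : 1 ≤ C := le_max_left _ _
  have ht0 : (1 : ℝ) ≤ t := by exact_mod_cast ht
  have hτ0 : (1 : ℝ) ≤ τ := by exact_mod_cast hτ
  have hpp : p ^ 2 = t * τ := Real.sq_sqrt (by positivity)
  have hp0 : 0 < p := Real.sqrt_pos.2 (by positivity)
  have hpq : p ≤ 2 * q := sqrt_le_two_mul_sqrt_mul_log (by positivity) hδ hδ'
  have hq0 : 0 < q := by linarith
  have hηq : η * C * q ≤ 1 / 4096 := by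
    rw [le_div_iff₀ (by positivity)] at hη'
    linarith
  have hηC : 0 < η * C := by positivity
  have hηp : η * C * p ≤ 1 / 2048 := by nlinarith
  have htp : √(t : ℝ) ≤ p := Real.sqrt_le_sqrt (by nlinarith)
  have hst : √(t : ℝ) * √(t : ℝ) = t := Real.mul_self_sqrt (by positivity)
  have hst0 : 0 < √(t : ℝ) := Real.sqrt_pos.2 (by positivity)
  have hBB : 1 ≤ B ^ 2 := one_le_pow₀ hB1
  have hcoef : η ^ 2 * G ^ 2 * (t * τ) ≤ B ^ 2 / 16384 := by
    have e : η ^ 2 * G ^ 2 * ((t : ℝ) * τ) = 16 * (η * C * p) ^ 2 * B ^ 2 := by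
      rw [hGdef, ← hpp]; ring
    have : (η * C * p) ^ 2 ≤ (1 / 2048) ^ 2 := pow_le_pow_left₀ (by positivity) hηp 2
    rw [e]
    nlinarith
  have hηGB : ∀ x, x ≤ p → η * (x * (2 * (G * B))) ≤ B ^ 2 / 256 := fun x hx => by
    have e : η * (p * (2 * (G * B))) = 8 * (η * C * p) * B ^ 2 := by rw [hGdef]; ring
    calc _ ≤ η * (p * (2 * (G * B))) := by gcongr
      _ ≤ _ := by rw [e]; nlinarith
  induction i using Nat.strong_induction_on with
  | _ i ih =>
  -- Negative regret could let the divergence grow, but near-optimality of `wref` limits it to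
  -- √t·D(wref, w₀) in total. Hence ‖w_k - wref‖²/2 ≤ B²/8 + D(wref, w₀)/2048, well below B²/2.
  have hball : ∀ k < i, ‖w k - wref‖ ≤ B := fun k hk => by
    have h1 := ih k hk (by omega)
    have h2 := hψ.half_sq_norm_le_bregman hwref (hrun.mem_interior k (by omega))
    have h3 : ∑ j ∈ Finset.range k, (risk ℓ π wref - risk ℓ π (w j))
        ≤ √(t : ℝ) * bregman ψ wref w₀ :=
      calc _ ≤ ∑ _j ∈ Finset.range k, bregman ψ wref w₀ / √(t : ℝ) :=
            Finset.sum_le_sum fun j hj => (risk_sub_le_excessRisk hℓ π ψ wref (interior_subset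
              (hrun.mem_interior j (by have := Finset.mem_range.1 hj; omega)))).trans hexcess
        _ = k * (bregman ψ wref w₀ / √(t : ℝ)) := by simp
        _ ≤ t * (bregman ψ wref w₀ / √(t : ℝ)) := by gcongr; omega
        _ = _ := by rw [mul_div_left_comm, Real.div_sqrt, mul_comm]
    have h4 : η * √(t : ℝ) ≤ 1 / 2048 :=
      calc _ ≤ η * p := by gcongr
        _ ≤ η * p * C := le_mul_of_one_le_right (by positivity) hC1
        _ ≤ _ := by linarith
    have h5 := mul_le_mul_of_nonneg_left h3 hη.le
    have h6 := mul_le_mul_of_nonneg_right h4 hD0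
    have h7 : ∑ j ∈ Finset.range k, (risk ℓ π (w j) - risk ℓ π wref)
        = -∑ j ∈ Finset.range k, (risk ℓ π wref - risk ℓ π (w j)) := by
      rw [← Finset.sum_neg_distrib]; simp
    rw [h7] at h1
    rw [norm_sub_rev] at h2
    refine abs_le_of_sq_le_sq' ?_ (by linarith only [hB1]) |>.2
    linarith only [h1, h2, h5, h6, hD16, hD0, hBB]
  rcases Nat.eq_zero_or_pos i with rfl | hi1
  · simp only [Finset.range_zero, Finset.sum_empty, mul_zero, add_zero, hrun.start]
    linarith
  have hgi : ∀ j < i, ‖g (j + 1)‖ ≤ G := fun j hj => hgrad j (by omega) (hball j hj)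
  have hmd := hrun.bregman_add_sum_le (wref := wref) hψ hη.le hi hgi
  -- The summand is the gap between risk and observed loss at w_j. In `b`, the first part restores
  -- the bias subtracted in `Y`; the second pays for moving from w_j to w_s once in the risk and
  -- once in the loss.
  have hsum := sum_range_le_of_lag
    (A := fun j => (risk ℓ π (w j) - risk ℓ π wref)
      - (pointLoss ℓ (z (j + 1)) (w j) - pointLoss ℓ (z (j + 1)) wref))
    (Y := fun s => ∫ x, clippedLoss ℓ wref B (x, w s) ∂π
          - clippedLoss ℓ wref B (z (s + τ), w s) - 2 * (G * B) * (1 / √(t : ℝ)))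
    (a := 2 * (G * B)) (b := 2 * (G * B) * (1 / √(t : ℝ)) + 2 * (G * (τ * (η * G))))
    (i := i) (by positivity) (by positivity) hτ (fun j hj => by
      have h1 := hrisk (w j) (hball j hj) wref
      have h2 := hlip (z (j + 1)) (hz _ (by omega) (by omega)) wref
        (by rw [sub_self, norm_zero]; linarith) (w j)
      rw [norm_sub_rev] at h2
      have h3 := mul_le_mul_of_nonneg_left (hball j hj) hG0.le
      linarith) (fun s hs => by
      have hzs := hz (s + τ) (by omega) (by omega)
      have hws := hball s (by omega)
      have hwj := hball (s + (τ - 1)) (by omega)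
      rw [integral_clippedLoss hℓ hπ hws, clippedLoss_of_le hzs hws,
        show s + (τ - 1) + 1 = s + τ by omega]
      have h1 := hrisk _ hwj (w s)
      have h2 := hlip _ hzs _ hws (w (s + (τ - 1)))
      rw [norm_sub_rev] at h2
      have h3 : ‖w (s + (τ - 1)) - w s‖ ≤ τ * (η * G) :=
        (hrun.norm_sub_le hψ hη.le (by omega) fun j hj => hgi j (by omega)).trans
          (by gcongr; omega)
      have h4 := mul_le_mul_of_nonneg_left h3 hG0.le
      linarith)
  have hc := hconc i hi1 hi
  have hit : (i : ℝ) ≤ t := by exact_mod_cast hi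
  have hmin : ((min i τ : ℕ) : ℝ) ≤ p := by
    refine Real.le_sqrt_of_sq_le ?_
    have h1 : ((min i τ : ℕ) : ℝ) ≤ t := by exact_mod_cast (min_le_left _ _).trans hi
    have h2 : ((min i τ : ℕ) : ℝ) ≤ τ := by exact_mod_cast min_le_right _ _
    rw [sq]
    gcongr
  have b1 := hηGB _ hmin
  have b2 : η * (G * B * √(2 * ((t : ℝ) * τ * Real.log (1 / δ)))) ≤ B ^ 2 / 256 := by
    have h2 : √(2 * ((t : ℝ) * τ * Real.log (1 / δ))) ≤ 2 * q := by
      rw [Real.sqrt_mul two_pos.le, ← hq]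
      gcongr
      exact Real.sqrt_le_iff.2 ⟨by norm_num, by norm_num⟩
    have e : η * (G * B * (2 * q)) = 8 * (η * C * q) * B ^ 2 := by rw [hGdef]; ring
    calc _ ≤ η * (G * B * (2 * q)) := by gcongr
      _ ≤ _ := by rw [e]; nlinarith
  have b3 : η * (i * (2 * (G * B) * (1 / √(t : ℝ)))) ≤ B ^ 2 / 256 := by
    have e : (t : ℝ) * (2 * (G * B) * (1 / √(t : ℝ))) = √(t : ℝ) * (2 * (G * B)) := by
      nth_rewrite 1 [← hst]; field_simp
    refine le_trans ?_ (hηGB _ htp)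
    rw [← e]
    gcongr
  have b4 : η * (i * (2 * (G * (τ * (η * G))))) ≤ B ^ 2 / 256 := by
    calc _ ≤ η * (t * (2 * (G * (τ * (η * G))))) := by gcongr
      _ = 2 * (η ^ 2 * G ^ 2 * (t * τ)) := by ring
      _ ≤ _ := by linarith
  have b5 : i * (η ^ 2 * G ^ 2 / 2) ≤ B ^ 2 / 256 := by
    calc _ ≤ (t * τ : ℝ) * (η ^ 2 * G ^ 2 / 2) := by
          gcongr
          exact hit.trans (le_mul_of_one_le_right (by positivity) hτ0)
      _ ≤ _ := by linarith
  rw [Finset.sum_sub_distrib] at hsum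
  have hsum' := mul_le_mul_of_nonneg_left hsum hη.le
  have hc' := mul_le_mul_of_nonneg_left hc hη.le
  simp only [mul_add] at hsum' hc'
  rw [mul_sub] at hsum'
  -- The budget is B²/16 for D(wref, w₀) plus five errors of B²/256, below B²/8.
  linarith only [hsum', hc', hmd, b1, b2, b3, b4, b5, hD16, hBB]

end Regret

end MirrorDescent

end

/-! ### Assembly: concentration plus the pathwise bound -/

theorem mainTheorem1
    {E : Type*} [NormedAddCommGroup E] [NormedSpace ℝ E] [FiniteDimensional ℝ E]
    {Ω : Type*} {mΩ : MeasurableSpace Ω} (μ : Measure Ω) [IsProbabilityMeasure μ]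
    -- the loss
    (ℓ : ℝ → ℝ → ℝ) (hℓ : MirrorDescent.IsConvexLoss ℓ)
    (C₁ C₂ : ℝ) (hC₁ : 0 ≤ C₁) (hC₂ : 0 ≤ C₂)
    (hquad : MirrorDescent.IsQuadraticallyBounded ℓ C₁ C₂)
    -- the data, with its approximate stationarity witness
    (t : ℕ) (ht : 1 ≤ t) (τ : ℕ) (hτ : 1 ≤ τ)
    (ℱ : Filtration ℕ mΩ) (Z : ℕ → Ω → MirrorDescent.DataPoint E) (hZ : Adapted ℱ Z)
    (π : Measure (MirrorDescent.DataPoint E)) [IsProbabilityMeasure π]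
    (hwit : MirrorDescent.IsStationarityWitness μ ℱ Z π τ (1 / √(t : ℝ)))
    (hbound : ∀ i, 1 ≤ i → i ≤ t → ∀ᵐ ω ∂μ, max ‖(Z i ω).1‖ |(Z i ω).2| ≤ 1)
    (hboundπ : ∀ᵐ z ∂π, max ‖z.1‖ |z.2| ≤ 1)
    -- the mirror map, the initial point and the reference solution
    (ψ : E → EReal) (hψ : MirrorDescent.IsMirrorMap ψ)
    (w₀ wref : E) (hwref : wref ∈ MirrorDescent.effDom ψ)
    (hexcess : MirrorDescent.excessRisk ℓ π ψ wref ≤ MirrorDescent.bregman ψ wref w₀ / √(t : ℝ))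
    -- the confidence parameter and the step size
    (δ : ℝ) (hδ : 0 < δ) (hδ' : δ ≤ 1 / 2)
    (η : ℝ) (hη : 0 < η)
    (hη' : η ≤ 1 / (4096 * max 1 (max C₁ C₂) * √((t : ℝ) * τ * Real.log (1 / δ))))
    -- the iterates, driven by the data `Z 1, …, Z t`
    (g : ℕ → Ω → StrongDual ℝ E) (hg : ∀ i, 1 ≤ i → i ≤ t → Measurable[ℱ i] (g i))
    (w : ℕ → Ω → E)
    (hw : ∀ ω, MirrorDescent.IsMirrorDescentRun ψ η t
      (fun i => MirrorDescent.pointLoss ℓ (Z i ω)) w₀ (fun i => g i ω) (fun i => w i ω)) :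
    1 - (t : ℝ) * τ * δ ≤
      μ.real {ω | ∀ i : ℕ, 1 ≤ i → i ≤ t →
        1 / ((i : ℝ) * η) * MirrorDescent.bregman ψ wref (w i ω)
            + 1 / (i : ℝ) * ∑ j ∈ Finset.range i, MirrorDescent.risk ℓ π (w j ω)
          ≤ (MirrorDescent.radius ψ C₂ wref w₀) ^ 2 / (8 * (i : ℝ) * η)
            + MirrorDescent.risk ℓ π wref} := by
  obtain ⟨ω₀⟩ := μ.nonempty_of_neZero
  borelize E
  have hB : 1 ≤ MirrorDescent.radius ψ C₂ wref w₀ := MirrorDescent.one_le_radius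
  have hG : 0 < MirrorDescent.lipConst ψ C₁ C₂ wref w₀ := MirrorDescent.lipConst_pos
  have hH := MirrorDescent.measurable_clippedLoss hℓ wref (MirrorDescent.radius ψ C₂ wref w₀)
  have hwm : ∀ i ≤ t, Measurable[ℱ i] (w i) := fun i hi =>
    MirrorDescent.measurable_iterate ℱ hψ hg hw hi
  have hM : 0 < MirrorDescent.lipConst ψ C₁ C₂ wref w₀ * MirrorDescent.radius ψ C₂ wref w₀ := by
    positivity
  have hconc := MirrorDescent.one_sub_le_measureReal_forall_sum_le μ (ℱ := ℱ)
    (Y := fun s ω =>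
      ∫ x, MirrorDescent.clippedLoss ℓ wref (MirrorDescent.radius ψ C₂ wref w₀) (x, w s ω) ∂π
        - MirrorDescent.clippedLoss ℓ wref (MirrorDescent.radius ψ C₂ wref w₀) (Z (s + τ) ω, w s ω)
        - 2 * (MirrorDescent.lipConst ψ C₁ C₂ wref w₀ * MirrorDescent.radius ψ C₂ wref w₀)
          * (1 / √(t : ℝ))) ht hτ
    (fun s hs => by
      have hws : Measurable[ℱ (s + τ)] (w s) :=
        (hwm s (by omega)).mono (ℱ.mono (by omega)) le_rfl
      refine Measurable.sub_const (Measurable.sub ?_ ?_) _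
      · exact (hH.stronglyMeasurable.integral_prod_left' (μ := π)).measurable.comp hws
      · exact hH.comp ((hZ (s + τ)).prodMk hws)) hM
    (fun s hs r hr W hW => MirrorDescent.lintegral_mul_exp_le_of_condLaw μ π (ℱ.le s)
      ((hZ (s + τ)).mono (ℱ.le _) le_rfl) (hwm s (by omega)) hH hM.le
      (MirrorDescent.abs_clippedLoss_le hquad hC₁ hC₂) (hwit s) hr hW) hδ (by linarith)
  refine hconc.trans ?_
  -- The good event implies the claim only off the null set where the data bound fails; clipping
  -- made the concentration independent of that bound.
  refine ENNReal.toReal_mono (measure_ne_top _ _) (measure_mono_ae ?_)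
  have hbound' : ∀ᵐ ω ∂μ, ∀ i, 1 ≤ i → i ≤ t → max ‖(Z i ω).1‖ |(Z i ω).2| ≤ 1 := by
    rw [ae_all_iff]
    intro i
    by_cases h : 1 ≤ i ∧ i ≤ t
    · filter_upwards [hbound i h.1 h.2] with ω hω _ _ using hω
    · exact ae_of_all _ fun ω h1 h2 => absurd ⟨h1, h2⟩ h
  filter_upwards [hbound'] with ω hω hgood i hi1 hit
  have hreg := (hw ω).bregman_add_regret_le hψ hℓ hquad hC₁ hC₂ ht hτ hω hboundπ hwref hexcess hδ hδ'
    hη hη' hgood hit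
  have hi0 : (0 : ℝ) < i := by exact_mod_cast hi1
  rw [Finset.sum_sub_distrib, Finset.sum_const, Finset.card_range, nsmul_eq_mul] at hreg
  have e : ∀ a b c d : ℝ, a + η * (b - i * c) ≤ d / 8 →
      1 / (i * η) * a + 1 / i * b ≤ d / (8 * i * η) + c := fun a b c d habcd => by
    have h1 : d / (8 * i * η) + c - (1 / (i * η) * a + 1 / i * b)
        = (d / 8 - (a + η * (b - i * c))) / (i * η) := by
      field_simp
      ring
    have h2 : 0 ≤ (d / 8 - (a + η * (b - i * c))) / (i * η) :=
      div_nonneg (by linarith) (by positivity)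
    linarith
  exact e _ _ _ _ hreg
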